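/- Fix a field $k$ and a real number $\epsilon\ge 0$. Order $\mathbb{R}\times\mathbb{R}^{\mathrm{op}}$ by $(s,t)\le(s',t')$ iff $s\le s'$ and $t'\le t$; a module is a functor from this poset to $k$-vector spaces. A subset $J$ of the poset is an interval if it is nonempty, order-convex ($p\le q\le r$ and $p,r\in J$ imply $q\in J$), and any two of its points are joined by a finite sequence of points of $J$ in which consecutive points are comparable. Its interval module $I^{J}$ is $k$ on $J$, with identity internal maps between points of $J$, and $0$ elsewhere. If $M\cong\bigoplus_{J\in\mathcal{B}(M)}I^{J}$ for a multiset $\mathcal{B}(M)$ of intervals, then $\mathcal{B}(M)$ (which is unique) is called the barcode of $M$. For $a,b\in\mathbb{R}$ put \[\langle a,b\rangle=\{(s,t)\mid a\le s,\ t\le b\},\qquad \langle a,b\rangle^{\epsilon}=\{(s,t)\in\langle a,b\rangle\mid t-s>2\epsilon\}.\] A module is free if it is isomorphic to a direct sum of modules $I^{\langle a,b\rangle}$. For a module $F$, let $R_\epsilon(F)$ be the module that agrees with $F$ at the points $(s,t)$ with $t-s>2\epsilon$ and is $0$ at all other points. A module is $R_\epsilon$-free if it is isomorphic to $R_\epsilon(F)$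 for some free module $F$ all of whose vector spaces are finite dimensional. A module $Q$ is $\epsilon$-trivial if all its internal maps $Q_{(s,t)}\to Q_{(s+\epsilon,t-\epsilon)}$ vanish. For $\delta\ge0$, an interval $J$ is $\delta$-trivial if $I^J$ is, i.e. if $(s,t)\in J$ implies $(s+\delta,t-\delta)\notin J$. A matching between multisets $S$ and $T$ is a bijection between a sub-multiset of $S$ (its coimage) and a sub-multiset of $T$ (its image). Corollary (Induced Matchings of $R_\epsilon$-Free Modules). Let $f:M\to N$ be a monomorphism (a morphism that is injective at every point) of $R_\epsilon$-free modules with $\epsilon$-trivial cokernel. Then there is a matching $\chi(f)$ between $\mathcal{B}(M)$ and $\mathcal{B}(N)$ such that (1) every pair matched by $\chi(f)$ is of the form $\chi(f)(\langle a,b\rangle^{\epsilon})=\langle a',b'\rangle^{\epsilon}$ with $a'\le a\le a'+\epsilon$ and $b'-\epsilon\le b\le b'$; (2) the coimage of $\chi(f)$ contains every interval of $\mathcal{B}(M)$ that is not $\epsilon$-trivial, and the image of $\chi(f)$ contains every interval of $\mathcal{B}(N)$ that is not $\tfrac{3}{2}\epsilon$-trivial. -/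

import Mathlib

open CategoryTheory
open scoped NNReal

universe u

namespace PersMod

/-- An interval of a poset: nonempty, order-convex, and connected through chains of pairwise
comparable elements. -/
structure PosetInterval (P : Type*) [PartialOrder P] where
  carrier : Set P
  nonempty : carrier.Nonempty
  ordConnected : carrier.OrdConnected
  connected : ∀ a ∈ carrier, ∀ c ∈ carrier,
    Relation.ReflTransGen (fun x y => x ∈ carrier ∧ y ∈ carrier ∧ (x ≤ y ∨ y ≤ x)) a c

section General

variable {k : Type u} [Field k] {P : Type} [PartialOrder P]

/-- The whole space `V` if `c` holds, and the zero subspace otherwise. -/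
def onlyIf (V : Type u) [AddCommGroup V] [Module k V] (c : Prop) : Submodule k V where
  carrier := {x | ¬ c → x = 0}
  add_mem' := by
    intro x y hx hy hc
    rw [hx hc, hy hc, add_zero]
  zero_mem' := fun _ => rfl
  smul_mem' := by
    intro r x hx hc
    rw [hx hc, smul_zero]

open Classical in
/-- The `P`-indexed module that agrees with `M` on the convex set `J` and is `0` off `J`; its
internal map from `p` to `q` is that of `M` if `p` and `q` lie in `J`, and is `0` otherwise. -/
noncomputable def restrictTo (M : P ⥤ ModuleCat.{u} k) (J : Set P) (hJ : J.OrdConnected) :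
    P ⥤ ModuleCat.{u} k where
  obj p := ModuleCat.of k (onlyIf (k := k) (M.obj p) (p ∈ J))
  map {p q} h := ModuleCat.ofHom
    (LinearMap.codRestrict (onlyIf (k := k) (M.obj q) (q ∈ J))
      (if q ∈ J then (M.map h).hom ∘ₗ (onlyIf (k := k) (M.obj p) (p ∈ J)).subtype else 0)
      (by
        intro x hq
        rw [if_neg hq]
        rfl))
  map_id p := by
    ext x
    by_cases hp : p ∈ J
    · simp [hp]
    · have : (x : M.obj p) = 0 := x.2 hp
      simp [hp, this]
  map_comp {p q r} h h' := by
    ext x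
    by_cases hr : r ∈ J
    · by_cases hq : q ∈ J
      · simp [hq, hr]
      · have hp : p ∉ J := fun hp => hq (hJ.out hp hr ⟨leOfHom h, leOfHom h'⟩)
        have : (x : M.obj p) = 0 := x.2 hp
        simp [hq, hr, this]
    · simp [hr]

/-- The interval module `I^J`: the field `k` on `J` with identity internal maps, `0` off `J`. -/
noncomputable def intervalModule (k : Type u) [Field k] (J : PosetInterval P) :
    P ⥤ ModuleCat.{u} k :=
  restrictTo ((Functor.const P).obj (ModuleCat.of k k)) J.carrier J.ordConnected

/-- The multiset of intervals `B`, given as an indexed family, is a barcode of `M`. -/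
def IsBarcode (M : P ⥤ ModuleCat.{u} k) {ι : Type u} (B : ι → PosetInterval P) : Prop :=
  Nonempty (M ≅ ∐ fun i => intervalModule k (B i))

/-- Pointwise finite dimensional modules. -/
def IsPFD (M : P ⥤ ModuleCat.{u} k) : Prop :=
  ∀ p, FiniteDimensional k (M.obj p)

end General

/-- The points `(s, t)` of the plane, carrying the order of `ℝ × ℝᵒᵖ`. -/
structure RRop where
  s : ℝ
  t : ℝ

/-- `(s, t) ≤ (s', t')` if and only if `s ≤ s'` and `t' ≤ t`. -/
instance : PartialOrder RRop where
  le p q := p.s ≤ q.s ∧ q.t ≤ p.t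
  le_refl p := ⟨le_refl p.s, le_refl p.t⟩
  le_trans _ _ _ h h' := ⟨h.1.trans h'.1, h'.2.trans h.2⟩
  le_antisymm := by
    rintro ⟨s, t⟩ ⟨s', t'⟩ h h'
    exact congrArg₂ RRop.mk (le_antisymm h.1 h'.1) (le_antisymm h'.2 h.2)

/-- The translate of `(s, t)` by `ε` in both coordinate directions of `ℝ × ℝᵒᵖ`, that is,
`(s + ε, t - ε)`. -/
def shift (ε : ℝ≥0) (p : RRop) : RRop := ⟨p.s + ε, p.t - ε⟩

theorem le_shift (ε : ℝ≥0) (p : RRop) : p ≤ shift ε p :=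
  ⟨le_add_of_nonneg_right ε.2, sub_le_self _ ε.2⟩

/-- The free interval `⟨a, b⟩ = {(s, t) | a ≤ s, t ≤ b}` of `ℝ × ℝᵒᵖ`. -/
def gen (a b : ℝ) : PosetInterval RRop where
  carrier := {p | a ≤ p.s ∧ p.t ≤ b}
  nonempty := ⟨⟨a, b⟩, le_refl a, le_refl b⟩
  ordConnected := ⟨fun _ hx _ _ _ hz => ⟨hx.1.trans hz.1.1, hz.1.2.trans hx.2⟩⟩
  connected := by
    intro x hx y hy
    have hm : a ≤ a ∧ b ≤ b := ⟨le_refl a, le_refl b⟩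
    exact (Relation.ReflTransGen.single (b := (⟨a, b⟩ : RRop)) ⟨hx, hm, Or.inr hx⟩).tail
      ⟨hm, hy, Or.inl hy⟩

/-- The region `t - s > 2ε`. -/
def aboveDiag (ε : ℝ≥0) : Set RRop :=
  {p | p.t - p.s > 2 * (ε : ℝ)}

theorem aboveDiag_ordConnected (ε : ℝ≥0) : (aboveDiag ε).OrdConnected := by
  refine ⟨fun x _ y hy z hz => ?_⟩
  have h1 : z.s ≤ y.s := hz.2.1
  have h2 : y.t ≤ z.t := hz.2.2
  have h3 : 2 * (ε : ℝ) < y.t - y.s := hy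
  change 2 * (ε : ℝ) < z.t - z.s
  linarith

/-- The truncated interval `{(s, t) | a ≤ s, t ≤ b, t - s > 2ε}`. -/
def truncGen (ε : ℝ≥0) (a b : ℝ) : Set RRop :=
  (gen a b).carrier ∩ aboveDiag ε

/-- A set `J` is `ε`-trivial if its translate by `ε` misses it. -/
def SetTrivial (ε : ℝ≥0) (J : Set RRop) : Prop :=
  ∀ p ∈ J, shift ε p ∉ J

section Modules

variable {k : Type u} [Field k]

/-- `M` is `ε`-trivial if all internal maps `M_p → M_(p+ε)` vanish. -/
def ModTrivial (ε : ℝ≥0) (M : RRop ⥤ ModuleCat.{u} k) : Prop :=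
  ∀ p, M.map (homOfLE (le_shift ε p)) = 0

/-- Free `ℝ × ℝᵒᵖ`-indexed modules: direct sums of interval modules on free intervals. -/
def IsFree (F : RRop ⥤ ModuleCat.{u} k) : Prop :=
  ∃ (ι : Type u) (ξ : ι → ℝ × ℝ), IsBarcode F fun i => gen (ξ i).1 (ξ i).2

/-- `R_ε(M)` agrees with `M` where `t - s > 2ε` and is `0` elsewhere. -/
noncomputable def truncate (ε : ℝ≥0) (M : RRop ⥤ ModuleCat.{u} k) : RRop ⥤ ModuleCat.{u} k :=
  restrictTo M (aboveDiag ε) (aboveDiag_ordConnected ε)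

/-- `R_ε`-free modules. -/
def IsRFree (ε : ℝ≥0) (M : RRop ⥤ ModuleCat.{u} k) : Prop :=
  ∃ F : RRop ⥤ ModuleCat.{u} k, IsPFD F ∧ IsFree F ∧ Nonempty (M ≅ truncate ε F)

end Modules

end PersMod

/-! Both modules are free over the down-set `t - s > 2ε`, with generators born at points x_i of M
and y_j of N. So f is a matrix C whose entry at (j, i) can be nonzero only if y_j ≤ x_i. Write y + ε
for `shift ε y`. As the cokernel is ε-trivial, every generator of N lifts to M after this shift; the
lifts form a matrix D whose nonzero entries force x_i ≤ y_j + ε. C ∘ D fixes each generator whose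
shift stays in the region, and injectivity of f yields the same for D ∘ C
(`IntervalBasis.exists_inverse_matrix`).

A pair may be matched when y_j ≤ x_i ≤ y_j + ε, and C and D each supply only one half of this.
Hall's condition still holds: if a set of generators had too few neighbours, some nonzero
combination v of them would have C v vanish at all these neighbours, and comparing D (C v) = v at
the entry of largest s - t gives a contradiction. The comparison is planar geometry
(`weight_lt_left`, `weight_lt_right`). This gives one injection from the non-ε-trivial bars of M and
one from those of N, and Mendelsohn–Dulmage merges them. All non-ε-trivial bars of N are covered,
which is more than the bound 3ε/2 asks. -/

namespace PersMod

/-! ### Combining matchings -/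

/-- A relation that is a partial injection in both directions is the graph of a `PEquiv`. -/
theorem exists_pequiv_of_biUnique {α β : Type*} (r : α → β → Prop) (hr : Relator.BiUnique r) :
    ∃ χ : α ≃. β, ∀ a b, b ∈ χ a ↔ r a b := by
  classical
  have h1 : ∀ a b, (b ∈ if h : ∃ b, r a b then some h.choose else none) ↔ r a b := by
    intro a b
    split_ifs with h
    · rw [Option.mem_some_iff]
      exact ⟨fun e => e ▸ h.choose_spec, fun e => hr.2 h.choose_spec e⟩
    · exact ⟨fun e => by simp at e, fun e => (h ⟨b, e⟩).elim⟩
  have h2 : ∀ a b, (a ∈ if h : ∃ a, r a b then some h.choose else none) ↔ r a b := by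
    intro a b
    split_ifs with h
    · rw [Option.mem_some_iff]
      exact ⟨fun e => e ▸ h.choose_spec, fun e => hr.1 h.choose_spec e⟩
    · exact ⟨fun e => by simp at e, fun e => (h ⟨a, e⟩).elim⟩
  exact ⟨⟨fun a => if h : ∃ b, r a b then some h.choose else none,
    fun b => if h : ∃ a, r a b then some h.choose else none,
    fun a b => (h2 a b).trans (h1 a b).symm⟩, h1⟩

/-- The Mendelsohn–Dulmage theorem: a matching that covers `A` and one that covers `B` combine
into a matching that covers both. -/
theorem exists_pequiv_of_injective {α β : Type*} (r : α → β → Prop) (A : Set α) (B : Set β)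
    (f : A → β) (hf : Function.Injective f) (hfr : ∀ a : A, r a (f a))
    (g : B → α) (hg : Function.Injective g) (hgr : ∀ b : B, r (g b) b) :
    ∃ χ : α ≃. β, (∀ a b, b ∈ χ a → r a b) ∧ (∀ a ∈ A, ∃ b, b ∈ χ a) ∧
      (∀ b ∈ B, ∃ a, b ∈ χ a) := by
  -- As in the Schröder–Bernstein proof: for a fixed point `S`, match by `f` on `S` and by the
  -- inverse of `g` off `S`.
  let Φ : Set α →o Set α :=
    { toFun := fun S => (g '' {b | ∀ a : A, (a : α) ∈ S → f a ≠ b})ᶜ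
      monotone' := by
        intro S T hST
        apply Set.compl_subset_compl.mpr
        apply Set.image_mono
        intro b hb a ha
        exact hb a (hST ha) }
  have hS : Φ Φ.lfp = Φ.lfp := Φ.map_lfp
  generalize Φ.lfp = S at hS
  have hmem : ∀ a, a ∉ S ↔ ∃ b : B, (∀ a : A, (a : α) ∈ S → f a ≠ b) ∧ g b = a := by
    intro a
    have h : a ∉ S ↔ a ∉ Φ S := by rw [hS]
    rw [h]
    exact not_not
  obtain ⟨χ, hχ⟩ := exists_pequiv_of_biUnique
    (fun a b => (a ∈ S ∧ ∃ h : a ∈ A, f ⟨a, h⟩ = b) ∨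
      (∃ h : b ∈ B, (∀ a : A, (a : α) ∈ S → f a ≠ b) ∧ g ⟨b, h⟩ = a)) (by
    constructor
    · rintro a a' b (⟨ha, hA, rfl⟩ | ⟨hB, hb, rfl⟩) (⟨ha', hA', e⟩ | ⟨hB', hb', e⟩)
      · exact congrArg Subtype.val (hf e).symm
      · exact (hb' ⟨a, hA⟩ ha rfl).elim
      · exact (hb ⟨a', hA'⟩ ha' e).elim
      · exact e
    · rintro a b b' (⟨ha, hA, rfl⟩ | ⟨hB, hb, rfl⟩) (⟨ha', hA', e⟩ | ⟨hB', hb', e⟩)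
      · exact e
      · exact ((hmem a).mpr ⟨⟨b', hB'⟩, hb', e⟩ ha).elim
      · exact ((hmem _).mpr ⟨⟨b, hB⟩, hb, rfl⟩ ha').elim
      · exact congrArg Subtype.val (hg e).symm)
  refine ⟨χ, fun a b hab => ?_, fun a ha => ?_, fun b hb => ?_⟩
  · rcases (hχ a b).mp hab with ⟨-, h, rfl⟩ | ⟨h, -, rfl⟩
    · exact hfr ⟨a, h⟩
    · exact hgr ⟨b, h⟩
  · by_cases h : a ∈ S
    · exact ⟨_, (hχ _ _).mpr (Or.inl ⟨h, ha, rfl⟩)⟩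
    · obtain ⟨b, hb, rfl⟩ := (hmem a).mp h
      exact ⟨b, (hχ _ _).mpr (Or.inr ⟨b.2, hb, rfl⟩)⟩
  · by_cases h : ∃ a : A, (a : α) ∈ S ∧ f a = b
    · obtain ⟨a, ha, rfl⟩ := h
      exact ⟨a, (hχ _ _).mpr (Or.inl ⟨ha, a.2, rfl⟩)⟩
    · push Not at h
      exact ⟨_, (hχ _ _).mpr (Or.inr ⟨hb, h, rfl⟩)⟩

/-! ### Hall's condition from a pair of matrices -/

section Hall

variable {k : Type*} [Field k] {α β : Type*}

theorem linearMap_apply_eq_zero (D : (β →₀ k) →ₗ[k] α →₀ k) (z : β →₀ k) (a : α)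
    (h : ∀ b, z b ≠ 0 → D (Finsupp.single b 1) a = 0) : D z a = 0 := by
  rw [← z.sum_single, Finsupp.sum, map_sum, Finsupp.finsetSum_apply]
  refine Finset.sum_eq_zero fun b hb => ?_
  rw [← mul_one (z b), ← smul_eq_mul, ← Finsupp.smul_single, map_smul, Finsupp.smul_apply,
    h b (Finsupp.mem_support_iff.mp hb), smul_zero]

/-- Hall's condition for the pairs `(a, b)` with `p b a` and `q a b`, where `p` and `q` bound the
supports of `C` and `D`, on a set where `D ∘ C` is the identity. -/
theorem card_le_card_biUnion_of_comp_eq_id [DecidableEq β]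
    (C : (α →₀ k) →ₗ[k] β →₀ k) (D : (β →₀ k) →ₗ[k] α →₀ k)
    (p : β → α → Prop) (q : α → β → Prop) (w : α → ℝ)
    (hC : ∀ a b, C (Finsupp.single a 1) b ≠ 0 → p b a)
    (hD : ∀ a b, D (Finsupp.single b 1) a ≠ 0 → q a b)
    (hw : ∀ a a' b, p b a → ¬ q a b → q a' b → ¬ p b a' → w a' < w a)
    (X : Finset α) (hX : ∀ a ∈ X, D (C (Finsupp.single a 1)) = Finsupp.single a 1)
    (t : α → Finset β) (ht : ∀ a ∈ X, ∀ b, p b a → q a b → b ∈ t a) :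
    X.card ≤ (X.biUnion t).card := by
  classical
  by_contra! hlt
  let ext : (X → k) →ₗ[k] α →₀ k :=
    Fintype.linearCombination k (fun a : X => Finsupp.single (a : α) (1 : k))
  have hext : ∀ v, ext v = ∑ a : X, v a • Finsupp.single (a : α) (1 : k) :=
    fun v => Fintype.linearCombination_apply k _ v
  let L : (X → k) →ₗ[k] ({b // b ∈ X.biUnion t} → k) :=
    LinearMap.pi fun b => Finsupp.lapply b.1 ∘ₗ C ∘ₗ ext
  -- With fewer neighbours than elements of `X`, some nonzero `v` on `X` has an image under `C` that
  -- vanishes at every neighbour.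
  obtain ⟨v, hv, hv0⟩ := (Submodule.ne_bot_iff _).mp
    (L.ker_ne_bot_of_finrank_lt (by simpa using hlt))
  have hvB : ∀ b ∈ X.biUnion t, C (ext v) b = 0 := fun b hb => congrFun hv ⟨b, hb⟩
  obtain ⟨a₀, ha₀⟩ : ∃ a, v a ≠ 0 := by
    by_contra! h
    exact hv0 (funext h)
  obtain ⟨m, hm, hmax⟩ := (Finset.univ.filter fun a : X => v a ≠ 0).exists_max_image
    (fun a => w a) ⟨a₀, by simpa using ha₀⟩
  have hm0 : v m ≠ 0 := by simpa using hm
  have hDC : D (C (ext v)) = ext v := by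
    rw [hext, map_sum, map_sum]
    refine Finset.sum_congr rfl fun a _ => ?_
    rw [map_smul, map_smul, hX a a.2]
  have hval : ext v m = v m := by
    rw [hext, Finsupp.finsetSum_apply, Finset.sum_eq_single m]
    · simp
    · intro a _ ha
      simp [Subtype.coe_injective.ne ha]
    · simp
  apply hm0
  rw [← hval, ← hDC]
  -- A `b` contributing to the entry at `m` is no neighbour, so `q m b` excludes `p b m`; an `a`
  -- contributing to `C (ext v)` at `b` has `p b a`, hence not `q a b`. Then `hw` makes `a` heavier
  -- than `m`.
  refine linearMap_apply_eq_zero D _ _ fun b hb => ?_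
  by_contra hDb
  have hqm := hD _ _ hDb
  have hbB : b ∉ X.biUnion t := fun h => hb (hvB b h)
  have hpm : ¬ p b m := fun h => hbB (Finset.mem_biUnion.mpr ⟨m, m.2, ht m m.2 b h hqm⟩)
  apply hb
  refine linearMap_apply_eq_zero C _ _ fun a ha => ?_
  by_contra hCb
  have hpa := hC _ _ hCb
  have haX : ∃ h : a ∈ X, v ⟨a, h⟩ ≠ 0 := by
    by_contra! h
    apply ha
    rw [hext, Finsupp.finsetSum_apply]
    refine Finset.sum_eq_zero fun a' _ => ?_
    by_cases e : (a' : α) = a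
    · subst e
      simp [h a'.2]
    · simp [e]
  obtain ⟨haX, hva⟩ := haX
  have hqa : ¬ q a b := fun h => hbB (Finset.mem_biUnion.mpr ⟨a, haX, ht a haX b hpa h⟩)
  exact (hw a m b hpa hqa hqm hpm).not_ge (hmax ⟨a, haX⟩ (by simpa using hva))

/-- Hall's theorem for a possibly infinite family needs each neighbourhood finite, whence `hfin`. -/
theorem exists_injective_of_comp_eq_id
    (C : (α →₀ k) →ₗ[k] β →₀ k) (D : (β →₀ k) →ₗ[k] α →₀ k)
    (p : β → α → Prop) (q : α → β → Prop) (w : α → ℝ)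
    (hC : ∀ a b, C (Finsupp.single a 1) b ≠ 0 → p b a)
    (hD : ∀ a b, D (Finsupp.single b 1) a ≠ 0 → q a b)
    (hw : ∀ a a' b, p b a → ¬ q a b → q a' b → ¬ p b a' → w a' < w a)
    (S : Set α) (hS : ∀ a ∈ S, D (C (Finsupp.single a 1)) = Finsupp.single a 1)
    (hfin : ∀ a ∈ S, {b | p b a ∧ q a b}.Finite) :
    ∃ g : S → β, Function.Injective g ∧ ∀ a : S, p (g a) a ∧ q a (g a) := by
  classical
  have hfin' : ∀ a, {b | a ∈ S ∧ p b a ∧ q a b}.Finite := fun a => by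
    by_cases ha : a ∈ S
    · exact (hfin a ha).subset fun b hb => hb.2
    · exact Set.finite_empty.subset fun b hb => ha hb.1
  obtain ⟨g, hg, hgt⟩ := (Finset.all_card_le_biUnion_card_iff_exists_injective
    fun a : S => (hfin' a).toFinset).mp fun X => by
      have := card_le_card_biUnion_of_comp_eq_id C D p q w hC hD hw
        (X.map (Function.Embedding.subtype _))
        (fun a ha => by
          obtain ⟨a', -, rfl⟩ := Finset.mem_map.mp ha
          exact hS a' a'.2)
        (fun a => (hfin' a).toFinset) (fun a ha b hp hq => by
          obtain ⟨a', -, rfl⟩ := Finset.mem_map.mp ha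
          exact (hfin' _).mem_toFinset.mpr ⟨a'.2, hp, hq⟩)
      rwa [Finset.card_map, Finset.map_eq_image, Finset.image_biUnion] at this
  exact ⟨g, hg, fun a => ((hfin' a).mem_toFinset.mp (hgt a)).2⟩

end Hall
-- Interval decompositions in coordinates
section IntervalBasis

variable {k : Type u} [Field k] {P : Type} [PartialOrder P]

/-- A decomposition of `M` into interval modules on the sets `J i`, in coordinates: `elt i p` is
the generator of the `i`-th summand at `p`, and `coord p` gives the coordinates of the elements
of `M.obj p` in the basis of all `elt i p` with `p ∈ J i`. -/
structure IntervalBasis (M : P ⥤ ModuleCat.{u} k) {ι : Type u} (J : ι → Set P) where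
  elt : ι → ∀ p, M.obj p
  coord : ∀ p, M.obj p →ₗ[k] ι →₀ k
  elt_of_notMem : ∀ i p, p ∉ J i → elt i p = 0
  coord_elt : ∀ i p, p ∈ J i → coord p (elt i p) = Finsupp.single i 1
  linearCombination_coord : ∀ p v, Finsupp.linearCombination k (fun i => elt i p) (coord p v) = v
  map_elt : ∀ i p q (h : p ⟶ q), p ∈ J i → M.map h (elt i p) = elt i q

namespace IntervalBasis

variable {M N : P ⥤ ModuleCat.{u} k} {ι : Type u} {J : ι → Set P} (b : IntervalBasis M J)

theorem coord_injective (p : P) : Function.Injective (b.coord p) :=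
  Function.LeftInverse.injective (b.linearCombination_coord p)

theorem ext_linearMap {V : Type*} [AddCommGroup V] [Module k V] {p : P} {f g : M.obj p →ₗ[k] V}
    (h : ∀ i, p ∈ J i → f (b.elt i p) = g (b.elt i p)) : f = g := by
  have : f ∘ₗ Finsupp.linearCombination k (fun i => b.elt i p) =
      g ∘ₗ Finsupp.linearCombination k (fun i => b.elt i p) := by
    refine Finsupp.lhom_ext' fun i => LinearMap.ext_ring ?_
    by_cases hi : p ∈ J i
    · simpa using h i hi
    · simp [b.elt_of_notMem i p hi]
  ext v
  rw [← b.linearCombination_coord p v]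
  exact LinearMap.congr_fun this _

theorem coord_of_notMem {i : ι} {p : P} (hi : p ∉ J i) (v : M.obj p) : b.coord p v i = 0 := by
  have : Finsupp.lapply i ∘ₗ b.coord p = (0 : M.obj p →ₗ[k] k) := by
    refine b.ext_linearMap fun j hj => ?_
    have : j ≠ i := fun e => hi (e ▸ hj)
    simp [b.coord_elt j p hj, this]
  exact LinearMap.congr_fun this v

theorem coord_linearCombination {p : P} (z : ι →₀ k) (hz : ∀ i, z i ≠ 0 → p ∈ J i) :
    b.coord p (Finsupp.linearCombination k (fun i => b.elt i p) z) = z := by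
  rw [Finsupp.linearCombination_apply, Finsupp.sum, map_sum]
  conv_rhs => rw [← z.sum_single, Finsupp.sum]
  refine Finset.sum_congr rfl fun i hi => ?_
  rw [map_smul, b.coord_elt i p (hz i (Finsupp.mem_support_iff.mp hi)), Finsupp.smul_single,
    smul_eq_mul, mul_one]

theorem coord_map {i : ι} {p q : P} (h : p ⟶ q) (hi : q ∈ J i) (v : M.obj p) :
    b.coord q (M.map h v) i = b.coord p v i := by
  have : Finsupp.lapply i ∘ₗ b.coord q ∘ₗ (M.map h).hom = Finsupp.lapply i ∘ₗ b.coord p := by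
    refine b.ext_linearMap fun j hj => ?_
    have e := b.map_elt j p q h hj
    by_cases hq : q ∈ J j
    · simp [e, b.coord_elt _ _ hj, b.coord_elt _ _ hq]
    · have : j ≠ i := fun e => hq (e ▸ hi)
      simp [e, b.coord_elt _ _ hj, b.elt_of_notMem _ _ hq, this]
  exact LinearMap.congr_fun this v

include b in
-- The generators alive at `p` are linearly independent. This is the source of the finite
-- neighbourhoods in Hall's theorem.
theorem finite_setOf_mem (p : P) [FiniteDimensional k (M.obj p)] : {i | p ∈ J i}.Finite := by
  have hli : LinearIndependent k fun i : {i | p ∈ J i} => b.elt i p := by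
    apply LinearIndependent.of_comp (b.coord p)
    have : (b.coord p ∘ fun i : {i | p ∈ J i} => b.elt i p) =
        fun i : {i | p ∈ J i} => Finsupp.single (i : ι) (1 : k) :=
      funext fun i => b.coord_elt _ _ i.2
    rw [this]
    exact (Finsupp.linearIndependent_single_one k ι).comp _ Subtype.val_injective
  exact Set.finite_coe_iff.mp hli.finite

/-- Transport along an isomorphism. -/
noncomputable def ofIso (φ : N ≅ M) : IntervalBasis N J where
  elt i p := φ.inv.app p (b.elt i p)
  coord p := b.coord p ∘ₗ (φ.hom.app p).hom
  elt_of_notMem i p hi := by rw [b.elt_of_notMem i p hi, map_zero]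
  coord_elt i p hi := by
    have : φ.hom.app p (φ.inv.app p (b.elt i p)) = b.elt i p := by
      rw [← ConcreteCategory.comp_apply, Iso.inv_hom_id_app, ConcreteCategory.id_apply]
    exact (congrArg (b.coord p) this).trans (b.coord_elt i p hi)
  linearCombination_coord p v := by
    have h : Finsupp.linearCombination k (fun i => φ.inv.app p (b.elt i p)) =
        (φ.inv.app p).hom ∘ₗ Finsupp.linearCombination k (fun i => b.elt i p) := by
      refine Finsupp.lhom_ext' fun i => LinearMap.ext_ring ?_
      simp
    rw [h]
    simp [b.linearCombination_coord]
  map_elt i p q h hi := by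
    rw [← b.map_elt i p q h hi, NatTrans.naturality_apply]

end IntervalBasis

theorem restrictTo_map_apply (M : P ⥤ ModuleCat.{u} k) {A : Set P} (hA : A.OrdConnected) {p q : P}
    (h : p ⟶ q) (hq : q ∈ A) (x : onlyIf (k := k) (M.obj p) (p ∈ A)) :
    ((restrictTo M A hA).map h x : onlyIf (k := k) (M.obj q) (q ∈ A)).1 = M.map h x.1 := by
  classical
  change (if q ∈ A then (M.map h).hom ∘ₗ (onlyIf (k := k) (M.obj p) (p ∈ A)).subtype else 0) x = _
  rw [if_pos hq]
  rfl

open Classical in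
/-- The decomposition of a restriction into the restricted intervals. -/
noncomputable def IntervalBasis.restrictTo {M : P ⥤ ModuleCat.{u} k} {ι : Type u} {J : ι → Set P}
    (b : IntervalBasis M J) {A : Set P} (hA : A.OrdConnected) :
    IntervalBasis (restrictTo M A hA) fun i => J i ∩ A where
  elt i p := (⟨if p ∈ A then b.elt i p else 0, fun h => if_neg h⟩ :
    onlyIf (k := k) (M.obj p) (p ∈ A))
  coord p := b.coord p ∘ₗ (onlyIf (k := k) (M.obj p) (p ∈ A)).subtype
  elt_of_notMem i p hi := by
    apply Subtype.ext
    by_cases hp : p ∈ A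
    · exact (if_pos hp).trans (b.elt_of_notMem i p fun h => hi ⟨h, hp⟩)
    · exact if_neg hp
  coord_elt i p hi := by
    change b.coord p (if p ∈ A then b.elt i p else 0) = _
    rw [if_pos hi.2, b.coord_elt i p hi.1]
  linearCombination_coord p v := by
    change onlyIf (k := k) (M.obj p) (p ∈ A) at v
    apply Subtype.ext
    by_cases hp : p ∈ A
    · refine Eq.trans ?_ (b.linearCombination_coord p v.1)
      simp only [Finsupp.linearCombination_apply]
      refine (map_finsuppSum (onlyIf (k := k) (M.obj p) (p ∈ A)).subtype _ _).trans ?_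
      refine Finsupp.sum_congr fun i _ => ?_
      change b.coord p v.1 i • (if p ∈ A then b.elt i p else 0) = _
      rw [if_pos hp]
      rfl
    · exact (Subtype.property (_ : onlyIf (k := k) (M.obj p) (p ∈ A)) hp).trans (v.2 hp).symm
  map_elt i p q h hi := by
    apply Subtype.ext
    by_cases hq : q ∈ A
    · refine (restrictTo_map_apply M hA h hq _).trans ?_
      change M.map h (if p ∈ A then b.elt i p else 0) = if q ∈ A then b.elt i q else 0
      rw [if_pos hq, if_pos hi.2, b.map_elt i p q h hi.1]
    · exact (Subtype.property (_ : onlyIf (k := k) (M.obj q) (q ∈ A)) hq).trans (if_neg hq).symm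

/-! ### Coordinates on a direct sum of interval modules -/

section Coproduct

variable {ι : Type u} (B : ι → PosetInterval P)

open Classical in
/-- The generator of the interval module at `p`, which is `0` off the interval. -/
noncomputable def intervalModuleElt (k : Type u) [Field k] (J : PosetInterval P) (p : P) :
    (intervalModule k J).obj p :=
  (⟨if p ∈ J.carrier then (1 : k) else 0, fun h => if_neg h⟩ : onlyIf (k := k) k (p ∈ J.carrier))

theorem intervalModuleElt_of_notMem {J : PosetInterval P} {p : P} (h : p ∉ J.carrier) :
    intervalModuleElt k J p = 0 :=
  Subtype.ext (if_neg h)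

theorem map_intervalModuleElt {J : PosetInterval P} {p q : P} (h : p ⟶ q) (hp : p ∈ J.carrier) :
    (intervalModule k J).map h (intervalModuleElt k J p) = intervalModuleElt k J q := by
  apply Subtype.ext
  by_cases hq : q ∈ J.carrier
  · refine (restrictTo_map_apply _ J.ordConnected h hq _).trans ?_
    exact (if_pos hp).trans (if_pos hq).symm
  · exact (Subtype.property (_ : onlyIf (k := k) k (q ∈ J.carrier)) hq).trans (if_neg hq).symm

theorem exists_eq_smul_intervalModuleElt {J : PosetInterval P} {p : P}
    (v : (intervalModule k J).obj p) : ∃ c : k, v = c • intervalModuleElt k J p := by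
  change onlyIf (k := k) k (p ∈ J.carrier) at v
  refine ⟨v.1, Subtype.ext ?_⟩
  classical
  change v.1 = v.1 * if p ∈ J.carrier then (1 : k) else 0
  by_cases hp : p ∈ J.carrier
  · rw [if_pos hp, mul_one]
  · rw [if_neg hp, mul_zero, v.2 hp]

theorem eq_zero_of_smul_intervalModuleElt_eq_zero {J : PosetInterval P} {p : P}
    (hp : p ∈ J.carrier) {c : k} (h : c • intervalModuleElt k J p = 0) : c = 0 := by
  classical
  have h' : c * (if p ∈ J.carrier then (1 : k) else 0) = 0 := congrArg Subtype.val h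
  rwa [if_pos hp, mul_one] at h'

/-- Evaluation at `p` preserves the coproduct, and the quotient by the span of the summands kills
every inclusion, so it is zero. -/
theorem iSup_range_ι_app {C : ι → P ⥤ ModuleCat.{u} k} (p : P) :
    ⨆ i, LinearMap.range ((Limits.Sigma.ι C i).app p).hom = ⊤ := by
  set S := ⨆ i, LinearMap.range ((Limits.Sigma.ι C i).app p).hom
  have hc := Limits.isColimitOfPreserves ((evaluation P (ModuleCat.{u} k)).obj p)
    (Limits.coproductIsCoproduct C)
  have h : ModuleCat.ofHom S.mkQ = 0 := by
    apply hc.hom_ext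
    rintro ⟨i⟩
    ext x
    apply (Submodule.Quotient.mk_eq_zero S).mpr
    exact Submodule.mem_iSup_of_mem i ⟨x, rfl⟩
  rw [← S.ker_mkQ, LinearMap.ker_eq_top]
  exact congrArg ModuleCat.Hom.hom h

/-- The generators of the summands of a direct sum of interval modules. -/
noncomputable def sigmaElt (k : Type u) [Field k] (i : ι) (p : P) :
    (∐ fun i => intervalModule k (B i) : P ⥤ ModuleCat.{u} k).obj p :=
  (Limits.Sigma.ι (fun i => intervalModule k (B i)) i).app p (intervalModuleElt k (B i) p)

theorem sigmaElt_of_notMem {i : ι} {p : P} (h : p ∉ (B i).carrier) : sigmaElt B k i p = 0 := by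
  rw [sigmaElt, intervalModuleElt_of_notMem h, map_zero]

open Classical in
theorem π_linearCombination_sigmaElt (i : ι) (p : P) (z : ι →₀ k) :
    (Limits.Sigma.π (fun i => intervalModule k (B i)) i).app p
      (Finsupp.linearCombination k (fun i => sigmaElt B k i p) z) =
      z i • intervalModuleElt k (B i) p := by
  have : ((Limits.Sigma.π (fun i => intervalModule k (B i)) i).app p).hom ∘ₗ
      Finsupp.linearCombination k (fun i => sigmaElt B k i p) =
      LinearMap.toSpanSingleton k _ (intervalModuleElt k (B i) p) ∘ₗ Finsupp.lapply i := by
    refine Finsupp.lhom_ext' fun j => LinearMap.ext_ring ?_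
    have e : (Limits.Sigma.π (fun i => intervalModule k (B i)) i).app p (sigmaElt B k j p) =
        (Limits.Sigma.ι (fun i => intervalModule k (B i)) j ≫
          Limits.Sigma.π (fun i => intervalModule k (B i)) i).app p
            (intervalModuleElt k (B j) p) := rfl
    by_cases hj : j = i
    · subst hj
      rw [Limits.Sigma.ι_π_eq_id] at e
      simpa using e
    · rw [Limits.Sigma.ι_π_of_ne _ hj] at e
      simpa [hj] using e
  exact LinearMap.congr_fun this z

/-- The projections onto the summands recover the coefficients, and the summands span. -/
theorem bijective_linearCombination_sigmaElt (p : P) : Function.Bijective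
    ((Finsupp.linearCombination k (fun i => sigmaElt B k i p)).domRestrict
      (Finsupp.supported k k {i | p ∈ (B i).carrier})) := by
  classical
  constructor
  · refine (injective_iff_map_eq_zero _).mpr ?_
    rintro ⟨z, hz⟩ h
    ext i
    by_cases hi : p ∈ (B i).carrier
    · apply eq_zero_of_smul_intervalModuleElt_eq_zero hi
      rw [← π_linearCombination_sigmaElt]
      exact (congrArg _ h).trans (map_zero _)
    · exact (Finsupp.mem_supported' k z).mp hz i hi
  · rw [← LinearMap.range_eq_top, ← top_le_iff, ← iSup_range_ι_app, iSup_le_iff]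
    rintro i _ ⟨v, rfl⟩
    obtain ⟨c, rfl⟩ := exists_eq_smul_intervalModuleElt v
    rw [map_smul]
    apply Submodule.smul_mem
    change sigmaElt B k i p ∈ _
    by_cases hi : p ∈ (B i).carrier
    · exact ⟨⟨Finsupp.single i 1, Finsupp.single_mem_supported k 1 hi⟩, by simp⟩
    · rw [sigmaElt_of_notMem B hi]
      exact Submodule.zero_mem _

/-- The decomposition of a direct sum of interval modules into its summands. -/
noncomputable def IntervalBasis.sigma :
    IntervalBasis (∐ fun i => intervalModule k (B i)) fun i => (B i).carrier where
  elt := sigmaElt B k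
  coord p := (Submodule.subtype _) ∘ₗ
    (LinearEquiv.ofBijective _ (bijective_linearCombination_sigmaElt B p)).symm.toLinearMap
  elt_of_notMem _ _ h := sigmaElt_of_notMem B h
  coord_elt i p hi := by
    have : sigmaElt B k i p = LinearEquiv.ofBijective _ (bijective_linearCombination_sigmaElt B p)
        ⟨Finsupp.single i 1, Finsupp.single_mem_supported k 1 hi⟩ := by simp
    rw [this, LinearMap.comp_apply, LinearEquiv.coe_coe, LinearEquiv.symm_apply_apply]
    rfl
  linearCombination_coord p v :=
    (LinearEquiv.ofBijective _ (bijective_linearCombination_sigmaElt B p)).apply_symm_apply v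
  map_elt i p q h hi := by
    rw [sigmaElt, ← NatTrans.naturality_apply, map_intervalModuleElt h hi]
    rfl

theorem IsBarcode.nonempty_intervalBasis {M : P ⥤ ModuleCat.{u} k} {B : ι → PosetInterval P}
    (h : IsBarcode M B) : Nonempty (IntervalBasis M fun i => (B i).carrier) :=
  ⟨(IntervalBasis.sigma B).ofIso h.some⟩

end Coproduct
end IntervalBasis
-- Barcodes and matrices for intervals with least elements
section UpperIntervals

variable {k : Type u} [Field k] {P : Type} [PartialOrder P] {M N : P ⥤ ModuleCat.{u} k}

/-- If `M` decomposes into intervals with least elements, then these are the only intervals in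
any barcode of `M`. -/
theorem IntervalBasis.exists_carrier_eq {ι κ : Type u} {B : ι → PosetInterval P} {T : κ → Set P}
    (b : IntervalBasis M fun i => (B i).carrier) (b' : IntervalBasis M T)
    (hT : ∀ i, (T i).Nonempty → ∃ x, IsLeast (T i) x) (j : ι) : ∃ i, (B j).carrier = T i := by
  obtain ⟨p, hp⟩ := (B j).nonempty
  -- Expanding `b.elt j p` in the other basis and back gives `j`-th coefficient 1, so some `i`
  -- contributes in both directions.
  obtain ⟨i, hci, hdi⟩ : ∃ i, b'.coord p (b.elt j p) i ≠ 0 ∧ b.coord p (b'.elt i p) j ≠ 0 := by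
    by_contra! h
    have h0 : b.coord p (b.elt j p) j = 0 := by
      rw [← b'.linearCombination_coord p (b.elt j p)]
      refine linearMap_apply_eq_zero
        (b.coord p ∘ₗ Finsupp.linearCombination k (fun i => b'.elt i p)) _ j fun i hi => ?_
      simpa using h i hi
    simp [b.coord_elt j p hp] at h0
  have hc : ∀ q r, q ≤ r → q ∈ (B j).carrier → r ∈ T i →
      b'.coord r (b.elt j r) i = b'.coord q (b.elt j q) i := by
    intro q r h hq hr
    rw [← b'.coord_map (homOfLE h) hr, b.map_elt j q r (homOfLE h) hq]
  have hd : ∀ q r, q ≤ r → q ∈ T i → r ∈ (B j).carrier →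
      b.coord r (b'.elt i r) j = b.coord q (b'.elt i q) j := by
    intro q r h hq hr
    rw [← b.coord_map (i := j) (homOfLE h) hr, b'.map_elt i q r (homOfLE h) hq]
  have hmem : ∀ q, b'.coord q (b.elt j q) i ≠ 0 → q ∈ T i := fun q h => by
    by_contra h'
    exact h (b'.coord_of_notMem h' _)
  have hmem' : ∀ q, b.coord q (b'.elt i q) j ≠ 0 → q ∈ (B j).carrier := fun q h => by
    by_contra h'
    exact h (b.coord_of_notMem (i := j) h' _)
  refine ⟨i, Set.Subset.antisymm (fun q hq => ?_) fun q hq => ?_⟩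
  -- Along a chain in `B j`, the first coefficient carries membership in `T i` downwards and the
  -- second carries it upwards.
  · suffices b'.coord q (b.elt j q) i ≠ 0 ∧ b.coord q (b'.elt i q) j ≠ 0 from hmem q this.1
    refine Relation.ReflTransGen.head_induction_on ((B j).connected q hq p hp) ⟨hci, hdi⟩ ?_
    rintro q r ⟨hq, hr, hqr⟩ - ⟨hcr, hdr⟩
    have hrT := hmem r hcr
    rcases hqr with h | h
    · have hcq : b'.coord q (b.elt j q) i ≠ 0 := by rwa [← hc q r h hq hrT]
      exact ⟨hcq, by rwa [← hd q r h (hmem q hcq) hr]⟩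
    · have hdq : b.coord q (b'.elt i q) j ≠ 0 := by rwa [hd r q h hrT hq]
      have hqT : q ∈ T i := by
        by_contra h'
        rw [b'.elt_of_notMem i q h', map_zero] at hdq
        exact hdq rfl
      exact ⟨by rwa [hc r q h hr hqT], hdq⟩
  -- The second coefficient places the least element of `T i` in `B j`; from there the first one
  -- propagates up to `q`.
  · obtain ⟨x, hxT, hx⟩ := hT i ⟨q, hq⟩
    have hpT := hmem p hci
    have hxB : x ∈ (B j).carrier := hmem' x (by rwa [← hd x p (hx hpT) hxT hp])
    by_contra hqB
    apply hci
    rw [hc x p (hx hpT) hxB hpT, ← hc x q (hx hq) hxB hq, b.elt_of_notMem j q hqB, map_zero]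
    rfl

variable {A : Set P} {ι κ : Type u} {x : ι → P} {y : κ → P}

/-- Inside `A` a generator never dies, so internal maps preserve coordinates; hence one matrix
describes a morphism at every point of `A`. -/
theorem IntervalBasis.coord_map_of_mem (b : IntervalBasis M fun i => Set.Ici (x i) ∩ A) {p q : P}
    (h : p ⟶ q) (hq : q ∈ A) (v : M.obj p) : b.coord q (M.map h v) = b.coord p v := by
  ext i
  by_cases hi : x i ≤ q
  · exact b.coord_map (i := i) h ⟨hi, hq⟩ v
  · rw [b.coord_of_notMem (i := i) fun h' => hi h'.1,
      b.coord_of_notMem (i := i) fun h' => hi (h'.1.trans (leOfHom h))]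

theorem IntervalBasis.le_of_coord_ne_zero (b : IntervalBasis M fun i => Set.Ici (x i) ∩ A) {p : P}
    {v : M.obj p} {i : ι} (h : b.coord p v i ≠ 0) : x i ≤ p := by
  by_contra h'
  exact h (b.coord_of_notMem (i := i) (fun h => h' h.1) v)

/-- The matrix of a morphism between modules that are free over `A`. -/
noncomputable def IntervalBasis.matrix (b : IntervalBasis M fun i => Set.Ici (x i) ∩ A)
    (b' : IntervalBasis N fun j => Set.Ici (y j) ∩ A) (f : M ⟶ N) : (ι →₀ k) →ₗ[k] κ →₀ k :=
  Finsupp.linearCombination k fun i => b'.coord (x i) (f.app (x i) (b.elt i (x i)))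

theorem IntervalBasis.coord_app (b : IntervalBasis M fun i => Set.Ici (x i) ∩ A)
    (b' : IntervalBasis N fun j => Set.Ici (y j) ∩ A) (f : M ⟶ N) (hx : ∀ i, x i ∈ A)
    {q : P} (hq : q ∈ A) (v : M.obj q) :
    b'.coord q (f.app q v) = b.matrix b' f (b.coord q v) := by
  have : b'.coord q ∘ₗ (f.app q).hom = b.matrix b' f ∘ₗ b.coord q := by
    refine b.ext_linearMap fun i hi => ?_
    have e := b.map_elt i (x i) q (homOfLE hi.1) ⟨le_rfl, hx i⟩
    have e' := NatTrans.naturality_apply f (homOfLE hi.1) (b.elt i (x i))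
    change b'.coord q (f.app q (b.elt i q)) = b.matrix b' f (b.coord q (b.elt i q))
    rw [b.coord_elt i q hi, ← e, e', b'.coord_map_of_mem _ hq]
    simp [IntervalBasis.matrix]
  exact LinearMap.congr_fun this v

/-- A monomorphism whose cokernel is killed by `σ` has a partial inverse up to `σ`. -/
theorem IntervalBasis.exists_inverse_matrix (b : IntervalBasis M fun i => Set.Ici (x i) ∩ A)
    (b' : IntervalBasis N fun j => Set.Ici (y j) ∩ A) (f : M ⟶ N)
    (hf : ∀ p, Function.Injective (f.app p).hom) (hA : IsLowerSet A) (hx : ∀ i, x i ∈ A)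
    (hy : ∀ j, y j ∈ A) {σ : P → P} (hσ : Monotone σ) (hσ' : ∀ p, p ≤ σ p)
    (hcoker : ∀ p (v : N.obj p), ∃ m, f.app (σ p) m = N.map (homOfLE (hσ' p)) v) :
    ∃ D : (κ →₀ k) →ₗ[k] ι →₀ k,
      (∀ j i, D (Finsupp.single j 1) i ≠ 0 → x i ≤ σ (y j)) ∧
      (∀ j, σ (y j) ∈ A → b.matrix b' f (D (Finsupp.single j 1)) = Finsupp.single j 1) ∧
      (∀ i, σ (x i) ∈ A → D (b.matrix b' f (Finsupp.single i 1)) = Finsupp.single i 1) := by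
  choose m hm using fun j => hcoker (y j) (b'.elt j (y j))
  let D : (κ →₀ k) →ₗ[k] ι →₀ k :=
    Finsupp.linearCombination k fun j => b.coord (σ (y j)) (m j)
  have hD : ∀ j, D (Finsupp.single j 1) = b.coord (σ (y j)) (m j) := fun j => by simp [D]
  have hsupp : ∀ j i, D (Finsupp.single j 1) i ≠ 0 → x i ≤ σ (y j) := fun j i h => by
    rw [hD] at h
    exact b.le_of_coord_ne_zero h
  -- Over `A` the matrix applied to the coordinates of the lift gives those of the shifted
  -- generator.
  have hCD : ∀ j, σ (y j) ∈ A →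
      b.matrix b' f (D (Finsupp.single j 1)) = Finsupp.single j 1 := by
    intro j hj
    rw [hD, ← b.coord_app b' f hx hj, hm, b'.coord_map_of_mem _ hj,
      b'.coord_elt _ _ ⟨le_rfl, hy j⟩]
  refine ⟨D, hsupp, hCD, fun i hi => ?_⟩
  set z := b.matrix b' f (Finsupp.single i 1) with hz
  have hzle : ∀ j, z j ≠ 0 → y j ≤ x i := fun j hj => by
    rw [hz, ← b.coord_elt i (x i) ⟨le_rfl, hx i⟩, ← b.coord_app b' f hx (hx i)] at hj
    exact b'.le_of_coord_ne_zero hj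
  -- Each `y j` in the support of `z` lies below `x i`, so `σ (y j)` lies below `σ (x i)` and stays
  -- in the down-set `A`.
  have hCDz : b.matrix b' f (D z) = z := by
    conv_rhs => rw [← z.sum_single]
    conv_lhs => rw [← z.sum_single]
    rw [Finsupp.sum, map_sum, map_sum]
    refine Finset.sum_congr rfl fun j hj => ?_
    rw [← mul_one (z j), ← smul_eq_mul, ← Finsupp.smul_single, map_smul, map_smul,
      hCD j (hA (hσ (hzle j (Finsupp.mem_support_iff.mp hj))) hi)]
  have hle : x i ≤ σ (x i) := hσ' _
  have hDz : b.coord (σ (x i)) (Finsupp.linearCombination k (fun i' => b.elt i' (σ (x i))) (D z)) =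
      D z := by
    refine b.coord_linearCombination _ fun i' hi' => ⟨?_, hi⟩
    by_contra h
    refine hi' (linearMap_apply_eq_zero D z i' fun j hj => ?_)
    by_contra h'
    exact h ((hsupp j i' h').trans (hσ (hzle j hj)))
  -- `D z` and the `i`-th basis vector are both coordinates of elements at `σ (x i)`, and these have
  -- the same image under the injective `f`.
  rw [← hDz, ← b.coord_elt i (σ (x i)) ⟨hle, hi⟩]
  congr 1
  apply hf
  apply b'.coord_injective
  refine (b.coord_app b' f hx hi _).trans (Eq.trans ?_ (b.coord_app b' f hx hi _).symm)
  rw [hDz, hCDz, b.coord_elt i (σ (x i)) ⟨hle, hi⟩]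

/-- Evaluating the exact sequence of the cokernel at `q` turns vanishing in the cokernel into a lift
along `f`. -/
theorem exists_app_eq_map (f : M ⟶ N) {p q : P} (h : p ⟶ q)
    (hcoker : (Limits.cokernel f).map h = 0) (v : N.obj p) :
    ∃ m, f.app q m = N.map h v := by
  have hex := (ShortComplex.exact_cokernel f).map ((evaluation P (ModuleCat.{u} k)).obj q)
  refine (ShortComplex.moduleCat_exact_iff _).mp hex (N.map h v) ?_
  change (Limits.cokernel.π f).app q (N.map h v) = 0
  rw [NatTrans.naturality_apply, hcoker]
  rfl

end UpperIntervals

/-! ### Geometry of the plane -/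

section Plane

variable {k : Type u} [Field k] {ε : ℝ≥0} {M N : RRop ⥤ ModuleCat.{u} k}

theorem monotone_shift (ε : ℝ≥0) : Monotone (shift ε) :=
  fun _ _ h => ⟨add_le_add_left h.1 _, sub_le_sub_right h.2 _⟩

theorem isLowerSet_aboveDiag (ε : ℝ≥0) : IsLowerSet (aboveDiag ε) := by
  intro p q h hp
  have h1 : q.s ≤ p.s := h.1
  have h2 : p.t ≤ q.t := h.2
  have h3 : 2 * (ε : ℝ) < p.t - p.s := hp
  change 2 * (ε : ℝ) < q.t - q.s
  linarith

theorem truncGen_eq (ε : ℝ≥0) (x : RRop) : truncGen ε x.s x.t = Set.Ici x ∩ aboveDiag ε := rfl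

theorem isLeast_truncGen {a b : ℝ} (h : (truncGen ε a b).Nonempty) :
    IsLeast (truncGen ε a b) ⟨a, b⟩ := by
  obtain ⟨p, hp, hp'⟩ := h
  exact ⟨⟨⟨le_rfl, le_rfl⟩, isLowerSet_aboveDiag ε hp hp'⟩, fun q hq => hq.1⟩

theorem shift_mem_aboveDiag {δ : ℝ≥0} (h : ε ≤ δ) {x : RRop}
    (hx : ¬ SetTrivial δ (truncGen ε x.s x.t)) : shift ε x ∈ aboveDiag ε := by
  simp only [SetTrivial, not_forall, not_not] at hx
  obtain ⟨p, hp, hp'⟩ := hx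
  refine isLowerSet_aboveDiag ε (le_trans ?_ (monotone_shift δ hp.1)) hp'.2
  have h' : (ε : ℝ) ≤ δ := h
  exact ⟨add_le_add_right h' _, sub_le_sub_left h' _⟩

/-- The barcode of an `R_ε`-free module consists of truncated free intervals. -/
theorem IsRFree.exists_carrier_eq (hM : IsRFree ε M) {ι : Type u} {B : ι → PosetInterval RRop}
    (hB : IsBarcode M B) :
    ∃ x : ι → RRop, ∀ i, x i ∈ aboveDiag ε ∧ (B i).carrier = truncGen ε (x i).s (x i).t := by
  obtain ⟨F, -, ⟨κ, ξ, hξ⟩, ⟨φ⟩⟩ := hM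
  obtain ⟨b⟩ := hB.nonempty_intervalBasis
  obtain ⟨b'⟩ := hξ.nonempty_intervalBasis
  have b'' : IntervalBasis M fun i => truncGen ε (ξ i).1 (ξ i).2 :=
    (b'.restrictTo (aboveDiag_ordConnected ε)).ofIso φ
  choose i hi using b.exists_carrier_eq b'' fun _ h => ⟨_, isLeast_truncGen h⟩
  refine ⟨fun j => ⟨(ξ (i j)).1, (ξ (i j)).2⟩, fun j => ⟨?_, hi j⟩⟩
  have h := (B j).nonempty
  rw [hi j] at h
  exact (isLeast_truncGen h).1.2

theorem IsRFree.isPFD (hM : IsRFree ε M) : IsPFD M := by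
  obtain ⟨F, hF, -, ⟨φ⟩⟩ := hM
  intro p
  have := hF p
  have : FiniteDimensional k ((truncate ε F).obj p) :=
    inferInstanceAs (FiniteDimensional k (onlyIf (k := k) (F.obj p) (p ∈ aboveDiag ε)))
  exact Module.Finite.equiv ((φ.app p).symm.toLinearEquiv)

/-- Use coordinates (s, -t), with weight their sum. `x` is at least `y` in both and beyond `y + ε`
in one, so it weighs more than `y` plus ε; `x'` is at most `y + ε` in both and below `y` in one, so
it weighs less. Three coordinates would only give 2ε in the second bound. -/
theorem weight_lt_left {x x' y : RRop} (h : y ≤ x) (h₁ : ¬ x ≤ shift ε y) (h₂ : x' ≤ shift ε y)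
    (h₃ : ¬ y ≤ x') : x'.s - x'.t < x.s - x.t := by
  have h : y.s ≤ x.s ∧ x.t ≤ y.t := h
  have h₁ : ¬ (x.s ≤ y.s + ε ∧ y.t - ε ≤ x.t) := h₁
  have h₂ : x'.s ≤ y.s + ε ∧ y.t - ε ≤ x'.t := h₂
  have h₃ : ¬ (y.s ≤ x'.s ∧ x'.t ≤ y.t) := h₃
  rw [not_and_or, not_le, not_le] at h₁ h₃
  rcases h₁ with h₁ | h₁ <;> rcases h₃ with h₃ | h₃ <;> linarith [h.1, h.2, h₂.1, h₂.2]

/-- Here both weights are compared with that of `x`: it exceeds the weight of `y'` by more than ε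
and that of `y` by less than ε. -/
theorem weight_lt_right {x y y' : RRop} (h : x ≤ shift ε y) (h₁ : ¬ y ≤ x) (h₂ : y' ≤ x)
    (h₃ : ¬ x ≤ shift ε y') : y'.s - y'.t < y.s - y.t := by
  have h : x.s ≤ y.s + ε ∧ y.t - ε ≤ x.t := h
  have h₁ : ¬ (y.s ≤ x.s ∧ x.t ≤ y.t) := h₁
  have h₂ : y'.s ≤ x.s ∧ x.t ≤ y'.t := h₂
  have h₃ : ¬ (x.s ≤ y'.s + ε ∧ y'.t - ε ≤ x.t) := h₃
  rw [not_and_or, not_le, not_le] at h₁ h₃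
  rcases h₁ with h₁ | h₁ <;> rcases h₃ with h₃ | h₃ <;> linarith [h.1, h.2, h₂.1, h₂.2]

end Plane
end PersMod

/-! ### The induced matching -/

theorem mainTheorem9 {k : Type u} [Field k] (ε : ℝ≥0)
    {M N : PersMod.RRop ⥤ ModuleCat.{u} k}
    (hM : PersMod.IsRFree ε M) (hN : PersMod.IsRFree ε N)
    (f : M ⟶ N) (hf : ∀ p, Function.Injective (f.app p).hom)
    (hcoker : PersMod.ModTrivial ε (Limits.cokernel f))
    {ι κ : Type u} (BM : ι → PersMod.PosetInterval PersMod.RRop)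
    (BN : κ → PersMod.PosetInterval PersMod.RRop)
    (hBM : PersMod.IsBarcode M BM) (hBN : PersMod.IsBarcode N BN) :
    ∃ χ : ι ≃. κ,
      (∀ i j, j ∈ χ i → ∃ a b a' b' : ℝ,
        (BM i).carrier = PersMod.truncGen ε a b ∧
        (BN j).carrier = PersMod.truncGen ε a' b' ∧
        (a' ≤ a ∧ a ≤ a' + ε) ∧ (b' - ε ≤ b ∧ b ≤ b')) ∧
      (∀ i, ¬ PersMod.SetTrivial ε (BM i).carrier → ∃ j, j ∈ χ i) ∧
      (∀ j, ¬ PersMod.SetTrivial (3 / 2 * ε) (BN j).carrier → ∃ i, j ∈ χ i) := by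
  open PersMod in
  obtain ⟨x, hx⟩ := hM.exists_carrier_eq hBM
  obtain ⟨y, hy⟩ := hN.exists_carrier_eq hBN
  obtain ⟨bM⟩ := hBM.nonempty_intervalBasis
  obtain ⟨bN⟩ := hBN.nonempty_intervalBasis
  simp only [fun i => (hx i).2, fun j => (hy j).2, truncGen_eq] at bM bN
  have hxA := fun i => (hx i).1
  have hyA := fun j => (hy j).1
  have hA := isLowerSet_aboveDiag ε
  obtain ⟨D, hD, hCD, hDC⟩ := bM.exists_inverse_matrix bN f hf hA hxA hyA (monotone_shift ε)
    (le_shift ε) fun p v => exists_app_eq_map f _ (hcoker p) v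
  have hC : ∀ i j, bM.matrix bN f (Finsupp.single i 1) j ≠ 0 → y j ≤ x i := fun i j h => by
    rw [← bM.coord_elt i (x i) ⟨Set.self_mem_Ici, hxA i⟩, ← bM.coord_app bN f hxA (hxA i)] at h
    exact bN.le_of_coord_ne_zero h
  obtain ⟨g, hg, hg'⟩ := exists_injective_of_comp_eq_id (bM.matrix bN f) D
    (fun j i => y j ≤ x i) (fun i j => x i ≤ shift ε (y j)) (fun i => (x i).s - (x i).t)
    hC (fun i j => hD j i) (fun _ _ _ => weight_lt_left) {i | shift ε (x i) ∈ aboveDiag ε} hDC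
    fun i _ => by
      have := hN.isPFD (x i)
      exact (bN.finite_setOf_mem (x i)).subset fun j hj => ⟨hj.1, hxA i⟩
  -- The same Hall argument with `C` and `D` exchanged covers the bars of N.
  obtain ⟨g', hg₁, hg₁'⟩ := exists_injective_of_comp_eq_id D (bM.matrix bN f)
    (fun i j => x i ≤ shift ε (y j)) (fun j i => y j ≤ x i) (fun j => (y j).s - (y j).t)
    hD (fun j i => hC i j) (fun _ _ _ => weight_lt_right) {j | shift ε (y j) ∈ aboveDiag ε} hCD
    fun j hj => by
      have := hM.isPFD (shift ε (y j))
      exact (bM.finite_setOf_mem (shift ε (y j))).subset fun i hi => ⟨hi.1, hj⟩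
  obtain ⟨χ, hχ, hχM, hχN⟩ := exists_pequiv_of_injective
    (fun i j => y j ≤ x i ∧ x i ≤ shift ε (y j)) _ _ g hg hg' g' hg₁ fun j => (hg₁' j).symm
  refine ⟨χ, fun i j hij => ?_, fun i hi => hχM i ?_, fun j hj => hχN j ?_⟩
  · obtain ⟨h, h'⟩ := hχ i j hij
    exact ⟨_, _, _, _, (hx i).2, (hy j).2, ⟨h.1, h'.1⟩, h'.2, h.2⟩
  · rw [(hx i).2] at hi
    exact shift_mem_aboveDiag le_rfl hi
  · rw [(hy j).2] at hj
    -- A bar that is not 3ε/2-trivial is not ε-trivial either, so only ε ≤ 3ε/2 is needed.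
    refine shift_mem_aboveDiag (le_mul_of_one_le_left zero_le ?_) hj
    rw [one_le_div₀ two_pos]
    exact_mod_cast (by norm_num : (2 : ℕ) ≤ 3)
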